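/- For $A\in\mathbb{Z}^{m\times n}$, $n\ge 1$, let $L_A$ be the largest absolute value of an entry of $A$, let $\Delta=\Delta(A)$ be the largest absolute value of a subdeterminant of $A$ (of any order), and let $\varphi_A$ be the largest binary encoding size of a row $a_i$ of $A$ (an integer entry takes one sign bit plus its binary digits). For a set $S\subseteq\mathbb{R}^n$ write $S_I=\mathrm{conv}(S\cap\mathbb{Z}^n)$, and let $\mathrm{vert}$ denote the set of vertices (extreme points). We say that a system $A'x\le b'$ with integer matrix $A'$ and solution set $P'$ satisfies the CKHM hypothesis with parameter $M\in\mathbb{N}$ if $b'_i-\min\{a_i'^{T}v : v\in\mathrm{vert}(P'_I)\}<2^M$ for every row $i$ (a condition that holds vacuously if $P'_I=\emptyset$). **Proposition.** There is a function $M=M(n,\varphi)$ with positive integer values and $M(n,\varphi)=O(n^2\varphi)$ (with an absolute constant, for $n,\varphi\ge1$) such that the following holds. Let $P=\{x\in\mathbb{R}^n: Ax\le b\}$ be a polytope (that is, bounded) with $A\in\mathbb{Z}^{m\times n}$, $b\in\mathbb{Z}^m$, $n\ge1$ and $P\cap\mathbb{Z}^n\ne\emptyset$. Put $M=M(n,\varphi_A)$,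 and for a vertex $\bar x$ of $P$ let $P_{\bar x}=\{x\in P:\|x-\bar x\|_\infty\le n\Delta\}$ be the corner relaxation at $\bar x$. Then: 1. every vertex of $P_I$ is a vertex of $(P_{\bar x})_I$ for some vertex $\bar x$ of $P$; 2. for every vertex $\bar x$ of $P$, the corner relaxation $P_{\bar x}$ is the solution set of the system that consists of the inequalities $a_i^Tx\le b_i$ with $b_i-a_i^T\bar x\le n^2L_A\Delta$ and of the box inequalities $\pm x_k\le\pm\bar x_k+n\Delta$ $(k=1,\dots,n)$, and this system satisfies the CKHM hypothesis with parameter $M$; 3. $|\mathrm{vert}(P_I)|\le 2\,m^{n}\,(6n^2M)^{n-1}$. In particular the bound on the number of vertices of the integer hull depends on $(n,m,\varphi_A)$ only, and not on $b$. -/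

import Mathlib

namespace IntHull

/-- The polyhedron `{x ∈ ℝⁿ : a_i · x ≤ b_i for all i}` of a linear system with integer coefficient
rows `a_i`. Right-hand sides are real, so that systems centred at a fractional point are covered. -/
def polyhedron {ι : Type} {n : ℕ} (A : Matrix ι (Fin n) ℤ) (b : ι → ℝ) : Set (Fin n → ℝ) :=
  {x | ∀ i, ∑ k, (A i k : ℝ) * x k ≤ b i}

/-- The integer lattice `ℤⁿ` inside `ℝⁿ`. -/
def lattice (n : ℕ) : Set (Fin n → ℝ) :=
  Set.range fun (z : Fin n → ℤ) (k : Fin n) => (z k : ℝ)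

/-- The integer hull `P_I = conv (P ∩ ℤⁿ)`. -/
def integerHull {n : ℕ} (P : Set (Fin n → ℝ)) : Set (Fin n → ℝ) :=
  convexHull ℝ (P ∩ lattice n)

/-- The vertices of a convex set, that is, its extreme points. -/
def vert {n : ℕ} (P : Set (Fin n → ℝ)) : Set (Fin n → ℝ) :=
  Set.extremePoints ℝ P

/-- The Cook-Hartmann-Kannan-McDiarmid hypothesis with parameter `M` for the system `A x ≤ b` with
solution set `P`: for every row `i`, `b_i - min {a_i · v : v ∈ vert P_I} < 2 ^ M`.
The bound on the minimum is written as a bound at every vertex of `P_I`. -/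
def CKHMHypothesis {ι : Type} {n : ℕ} (A : Matrix ι (Fin n) ℤ) (b : ι → ℝ) (M : ℕ) : Prop :=
  ∀ i, ∀ v ∈ vert (integerHull (polyhedron A b)), b i - ∑ k, (A i k : ℝ) * v k < 2 ^ M

/-- `φ_A`: the largest binary encoding size of a row of `A`, where an integer entry takes a sign bit
plus its binary digits. -/
def rowEncodingSize {m n : ℕ} (A : Matrix (Fin m) (Fin n) ℤ) : ℕ :=
  Finset.univ.sup fun i => ∑ k, (1 + Nat.size (A i k).natAbs)

/-- `L_A`: the largest absolute value of an entry of `A`. -/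
def maxEntry {m n : ℕ} (A : Matrix (Fin m) (Fin n) ℤ) : ℕ :=
  Finset.univ.sup fun i => Finset.univ.sup fun k => (A i k).natAbs

/-- `Δ(A)`: the largest absolute value of a subdeterminant of `A` (of any order `1, …, n`; a
repeated row or column only contributes the value `0`). -/
def maxSubdet {m n : ℕ} (A : Matrix (Fin m) (Fin n) ℤ) : ℕ :=
  (Finset.Icc 1 n).sup fun k =>
    Finset.univ.sup fun p : (Fin k → Fin m) × (Fin k → Fin n) =>
      (A.submatrix p.1 p.2).det.natAbs

/-- The corner relaxation at `x`: `{y ∈ P : ‖y - x‖_∞ ≤ n Δ(A)}` for `P = {y : A y ≤ b}`. -/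
def cornerRelaxation {m n : ℕ} (A : Matrix (Fin m) (Fin n) ℤ) (b : Fin m → ℝ)
    (x : Fin n → ℝ) : Set (Fin n → ℝ) :=
  polyhedron A b ∩ {y | ∀ k, |y k - x k| ≤ (n : ℝ) * maxSubdet A}

/-- The rows of `A x ≤ b` kept in the corner relaxation at `x`: those whose slack at `x` is at most
`n² L_A Δ(A)`. -/
abbrev KeptRow {m n : ℕ} (A : Matrix (Fin m) (Fin n) ℤ) (b : Fin m → ℝ) (x : Fin n → ℝ) : Type :=
  {i : Fin m // b i - ∑ k, (A i k : ℝ) * x k ≤ (n : ℝ) ^ 2 * maxEntry A * maxSubdet A}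

/-- Coefficients of the system of the corner relaxation at `x`: the kept rows of `A`, and the box
rows `e_k` and `-e_k`. -/
def cornerMatrix {m n : ℕ} (A : Matrix (Fin m) (Fin n) ℤ) (b : Fin m → ℝ) (x : Fin n → ℝ) :
    Matrix (KeptRow A b x ⊕ Fin n ⊕ Fin n) (Fin n) ℤ :=
  Sum.elim (fun i => A i.1)
    (Sum.elim (fun k l => if l = k then 1 else 0) (fun k l => if l = k then -1 else 0))

/-- Right-hand sides of the system of the corner relaxation at `x`: `b_i` for the kept rows, and
`x_k + n Δ(A)` and `-x_k + n Δ(A)` for the box rows. -/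
def cornerRHS {m n : ℕ} (A : Matrix (Fin m) (Fin n) ℤ) (b : Fin m → ℝ) (x : Fin n → ℝ) :
    KeptRow A b x ⊕ Fin n ⊕ Fin n → ℝ :=
  Sum.elim (fun i => b i.1)
    (Sum.elim (fun k => x k + (n : ℝ) * maxSubdet A) (fun k => -x k + (n : ℝ) * maxSubdet A))

end IntHull

namespace IntHull

open Finset

/-! The count rests on a reflection: if u and v are vertices of P_I and every slack of u is at most
twice that of v, then 2v - u is an integer point of P and v is the midpoint of u and 2v - u, so u =
v (`eq_of_slack_le_two_mul`). It remains to sort the vertices into few classes within which slacks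
agree up to a factor 2.

By Helly, P has a center c whose slacks are at least 1/(n+1) of the maximal ones (`exists_center`).
At most one vertex u is so central that c + 2(n+1)(u - c) stays in P. Any other is projected from c
to a point p on the hyperplane of some row. Its class records the dilation factor on a grid of step
1/3, the row, and the position of all slacks of p among T + 1 geometric levels. Sauer-Shelah on the
hyperplane leaves at most (m(T+1)+1)^(n-1) patterns (`card_patterns_le`).

T does not depend on b because a vertex of P_I lies within nΔ of a vertex of P (`exists_vert_near`):
rows tight there have bounded slack at p and determine p up to a bounded error by Cramer's rule, so
slacks above the top level are automatically comparable (`slack_comparison`). Geometric growth of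
the levels gives T = O(nφ). The same proximity yields the first claim; the second holds because a
row varies by at most n²LΔ over the box. -/

/-- The linear functional given by a row of an integer matrix. -/
def row {ι : Type} {n : ℕ} (A : Matrix ι (Fin n) ℤ) (i : ι) : (Fin n → ℝ) →ₗ[ℝ] ℝ where
  toFun x := ∑ k, (A i k : ℝ) * x k
  map_add' x y := by simp [mul_add, sum_add_distrib]
  map_smul' c x := by simp [mul_sum, mul_left_comm]

/-- The real vector with the given integer coordinates. -/
def intVec {n : ℕ} (g : Fin n → ℤ) : Fin n → ℝ := fun k => (g k : ℝ)

/-! ### Polyhedra, feasible directions and the reflection argument -/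

section Basic

variable {ι : Type} {n : ℕ} {A : Matrix ι (Fin n) ℤ} {b : ι → ℝ}

lemma row_apply (i : ι) (x : Fin n → ℝ) : row A i x = ∑ k, (A i k : ℝ) * x k := rfl

lemma row_intVec (i : ι) (g : Fin n → ℤ) : row A i (intVec g) = ((∑ k, A i k * g k : ℤ) : ℝ) := by
  simp [row_apply, intVec]

lemma mem_polyhedron {x : Fin n → ℝ} : x ∈ polyhedron A b ↔ ∀ i, row A i x ≤ b i := Iff.rfl

lemma continuous_row (i : ι) : Continuous (row A i) := by
  change Continuous fun x : Fin n → ℝ => ∑ k, (A i k : ℝ) * x k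
  fun_prop

lemma convex_polyhedron : Convex ℝ (polyhedron A b) := by
  have : polyhedron A b = ⋂ i, {x | row A i x ≤ b i} := by
    ext x; simp [mem_polyhedron]
  rw [this]
  exact convex_iInter fun i => convex_halfSpace_le (row A i).isLinear _

lemma isClosed_polyhedron : IsClosed (polyhedron A b) := by
  have : polyhedron A b = ⋂ i, {x | row A i x ≤ b i} := by
    ext x; simp [mem_polyhedron]
  rw [this]
  exact isClosed_iInter fun i => isClosed_le (continuous_row i) continuous_const

lemma abs_row_le {L D : ℝ} (i : ι) (hL : ∀ k, |(A i k : ℝ)| ≤ L)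
    {x : Fin n → ℝ} (hx : ∀ k, |x k| ≤ D) : |row A i x| ≤ n * L * D := by
  calc |row A i x| = |∑ k, (A i k : ℝ) * x k| := rfl
    _ ≤ ∑ k, |(A i k : ℝ) * x k| := abs_sum_le_sum_abs _ _
    _ ≤ ∑ _k : Fin n, L * D := by
        refine sum_le_sum fun k _ => ?_
        rw [abs_mul]
        exact mul_le_mul (hL k) (hx k) (abs_nonneg _) ((abs_nonneg _).trans (hL k))
    _ = n * L * D := by simp; ring

lemma integerHull_subset (P : Set (Fin n → ℝ)) (hP : Convex ℝ P) : integerHull P ⊆ P :=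
  convexHull_min Set.inter_subset_left hP

lemma vert_integerHull_subset (P : Set (Fin n → ℝ)) : vert (integerHull P) ⊆ P ∩ lattice n :=
  extremePoints_convexHull_subset

lemma add_intVec_mem_lattice {x : Fin n → ℝ} (hx : x ∈ lattice n) (g : Fin n → ℤ) :
    x + intVec g ∈ lattice n := by
  obtain ⟨z, rfl⟩ := hx
  exact ⟨z + g, by ext k; simp [intVec]⟩

/-- The rows of a nonempty bounded polyhedron have trivial common kernel. -/
lemma eq_zero_of_row_eq_zero (hb : Bornology.IsBounded (polyhedron A b))
    (hne : (polyhedron A b).Nonempty) (w : Fin n → ℝ) (hw : ∀ i, row A i w = 0) : w = 0 := by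
  obtain ⟨x, hx⟩ := hne
  by_contra h
  obtain ⟨R, hR⟩ := hb.exists_norm_le
  have hn : 0 < ‖w‖ := norm_pos_iff.2 h
  have hR0 : 0 ≤ R := (norm_nonneg x).trans (hR x hx)
  -- The whole line through `x` along `w` is feasible; this `t` gives a displacement of length `2R +
  -- 1`, too long for two points of norm at most `R`.
  set t : ℝ := (2 * R + 1) / ‖w‖
  have h1 : x + t • w ∈ polyhedron A b := fun i => by
    have := hx i
    rw [← row_apply] at this ⊢
    simpa [hw i] using this
  have h2 := hR _ h1
  have h3 : ‖t • w‖ = 2 * R + 1 := by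
    rw [norm_smul, Real.norm_of_nonneg (by positivity)]
    exact div_mul_cancel₀ _ hn.ne'
  have h4 : ‖t • w‖ ≤ ‖x + t • w‖ + ‖x‖ := by
    simpa using norm_sub_le (x + t • w) x
  linarith [hR x hx]

/-- A feasible direction at a point of a polyhedron. -/
lemma exists_pos_add_smul_mem [Finite ι] {x : Fin n → ℝ} (hx : x ∈ polyhedron A b)
    (w : Fin n → ℝ) (hw : ∀ i, row A i x = b i → row A i w ≤ 0) :
    ∃ ε : ℝ, 0 < ε ∧ x + ε • w ∈ polyhedron A b := by
  have h : ∀ᶠ ε in nhdsWithin (0 : ℝ) (Set.Ioi 0), ∀ i, row A i (x + ε • w) ≤ b i := by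
    rw [Filter.eventually_all]
    intro i
    rcases eq_or_lt_of_le (mem_polyhedron.1 hx i) with h | h
    · filter_upwards [self_mem_nhdsWithin] with ε hε
      have : ε * row A i w ≤ 0 := mul_nonpos_of_nonneg_of_nonpos (le_of_lt hε) (hw i h)
      simp only [map_add, map_smul, smul_eq_mul]
      linarith
    · have hc : Filter.Tendsto (fun ε : ℝ => row A i (x + ε • w)) (nhds 0)
          (nhds (row A i (x + (0 : ℝ) • w))) :=
        ((continuous_row i).comp (by fun_prop : Continuous fun ε : ℝ => x + ε • w)).tendsto 0
      have := hc.eventually_lt_const (u := b i) (by simpa using h)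
      exact (this.filter_mono nhdsWithin_le_nhds).mono fun _ h => h.le
  obtain ⟨ε, h1, h2⟩ := (h.and self_mem_nhdsWithin).exists
  exact ⟨ε, h2, h1⟩

/-- The rows that are tight at a vertex have trivial common kernel. -/
lemma eq_zero_of_tight [Finite ι] {x : Fin n → ℝ} (hx : x ∈ vert (polyhedron A b))
    (w : Fin n → ℝ) (hw : ∀ i, row A i x = b i → row A i w = 0) : w = 0 := by
  obtain ⟨ε, hε, h1⟩ := exists_pos_add_smul_mem hx.1 w fun i hi => (hw i hi).le
  obtain ⟨δ, hδ, h2⟩ := exists_pos_add_smul_mem hx.1 (-w) fun i hi => by simp [hw i hi]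
  have := hx.2 h1 h2 ⟨δ / (ε + δ), ε / (ε + δ), by positivity, by positivity, by field_simp; ring,
    by ext k; simp; field_simp; ring⟩
  have h3 : ε • w = 0 := by simpa using this
  exact (smul_eq_zero.1 h3).resolve_left hε.ne'

/-- If the slacks of a vertex of the integer hull are at most twice those of another vertex, then
reflecting the former in the latter stays in the polyhedron. -/
lemma eq_of_slack_le_two_mul {u v : Fin n → ℝ} (hu : u ∈ vert (integerHull (polyhedron A b)))
    (hv : v ∈ vert (integerHull (polyhedron A b)))
    (h : ∀ i, b i - row A i u ≤ 2 * (b i - row A i v)) : u = v := by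
  have hu' := vert_integerHull_subset _ hu
  have hv' := vert_integerHull_subset _ hv
  obtain ⟨z, hz⟩ := hu'.2
  obtain ⟨y, hy⟩ := hv'.2
  have hw : (2 : ℝ) • v - u ∈ polyhedron A b ∩ lattice n := by
    refine ⟨fun i => ?_, ⟨2 * y - z, ?_⟩⟩
    · rw [← row_apply]
      have := h i
      simp only [map_sub, map_smul, smul_eq_mul]
      linarith
    · rw [← hz, ← hy]; ext k; simp
  refine hv.2 (subset_convexHull ℝ _ hu') (subset_convexHull ℝ _ hw)
    ⟨1 / 2, 1 / 2, by norm_num, by norm_num, by norm_num, ?_⟩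
  ext k; simp; ring

lemma finite_inter_lattice {P : Set (Fin n → ℝ)} (hP : Bornology.IsBounded P) :
    (P ∩ lattice n).Finite := by
  obtain ⟨R, hR⟩ := hP.exists_norm_le
  refine ((Set.finite_Icc (fun _ : Fin n => -⌈R⌉) (fun _ => ⌈R⌉)).image
    (fun z k => ((z k : ℤ) : ℝ))).subset ?_
  rintro _ ⟨hx, z, rfl⟩
  refine ⟨z, ⟨fun k => ?_, fun k => ?_⟩, rfl⟩ <;>
  · have h1 := (norm_le_pi_norm _ k).trans (hR _ hx)
    have h2 := abs_le.1 (Real.norm_eq_abs _ ▸ h1)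
    have h3 := Int.le_ceil R
    have h4 : (-⌈R⌉ : ℝ) ≤ z k := by linarith
    have h5 : (z k : ℝ) ≤ ⌈R⌉ := by linarith
    first | exact_mod_cast h4 | exact_mod_cast h5

end Basic

/-! ### Cramer's rule and subdeterminants -/

section Determinants

variable {n m : ℕ} (A : Matrix (Fin m) (Fin n) ℤ)

lemma abs_entry_le (i : Fin m) (k : Fin n) : |(A i k : ℝ)| ≤ maxEntry A := by
  have : (A i k).natAbs ≤ maxEntry A :=
    (le_sup (f := fun k => (A i k).natAbs) (mem_univ k)).trans
      (le_sup (f := fun i => univ.sup fun k => (A i k).natAbs) (mem_univ i))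
  calc |(A i k : ℝ)| = ((A i k).natAbs : ℝ) := by rw [Nat.cast_natAbs]; simp
    _ ≤ _ := by exact_mod_cast this

lemma natAbs_det_submatrix_le {k : ℕ} (hk : 1 ≤ k) (hkn : k ≤ n) (f : Fin k → Fin m)
    (g : Fin k → Fin n) : (A.submatrix f g).det.natAbs ≤ maxSubdet A := by
  refine le_trans ?_ (le_sup (f := fun k => univ.sup
    fun p : (Fin k → Fin m) × (Fin k → Fin n) => (A.submatrix p.1 p.2).det.natAbs)
    (mem_Icc.2 ⟨hk, hkn⟩))
  exact le_sup (f := fun p : (Fin k → Fin m) × (Fin k → Fin n) =>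
    (A.submatrix p.1 p.2).det.natAbs) (mem_univ (f, g))

variable {A}

/-- The entries of the adjugate of a nonsingular square row selection are bounded by the largest
subdeterminant. -/
lemma natAbs_adjugate_le {f : Fin n → Fin m} (hf : (A.submatrix f id).det ≠ 0) (i j : Fin n) :
    ((A.submatrix f id).adjugate i j).natAbs ≤ maxSubdet A := by
  obtain _ | n := n
  · exact i.elim0
  rw [Matrix.adjugate_fin_succ_eq_det_submatrix, Int.natAbs_mul, Int.natAbs_pow, Int.natAbs_neg,
    Int.natAbs_one, one_pow, one_mul, Matrix.submatrix_submatrix]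
  -- In dimension one the adjugate entry is the empty determinant 1, which `maxSubdet` does not
  -- range over; it is bounded by the nonzero determinant itself.
  obtain _ | n := n
  · refine le_trans ?_ (natAbs_det_submatrix_le A le_rfl le_rfl f id)
    rw [Matrix.det_fin_zero]
    simpa [Nat.one_le_iff_ne_zero] using hf
  · exact natAbs_det_submatrix_le A (by omega) (by omega) _ _

/-- Rows with trivial common kernel contain a nonsingular square row selection. -/
lemma exists_submatrix_det_ne_zero (s : Set (Fin m))
    (h : ∀ w, (∀ i ∈ s, row A i w = 0) → w = 0) :
    ∃ f : Fin n → Fin m, (∀ j, f j ∈ s) ∧ (A.submatrix f id).det ≠ 0 := by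
  classical
  let B : Matrix s (Fin n) ℝ := fun i k => (A i k : ℝ)
  have hrank : B.rank = n := by
    have hker : LinearMap.ker B.mulVecLin = ⊥ := by
      rw [LinearMap.ker_eq_bot']
      intro w hw
      exact h w fun i hi => congrFun hw ⟨i, hi⟩
    have := LinearMap.finrank_range_add_finrank_ker B.mulVecLin
    rw [hker, finrank_bot, add_zero] at this
    simpa [Matrix.rank] using this
  rw [Matrix.rank_eq_finrank_span_row] at hrank
  obtain ⟨κ, a, ha, hsp, hli⟩ := exists_linearIndependent' ℝ B.row
  have : Finite κ := Finite.of_injective a ha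
  have := Fintype.ofFinite κ
  rw [← hsp, finrank_span_eq_card hli] at hrank
  let e : Fin n ≃ κ := (Fintype.equivFinOfCardEq hrank).symm
  refine ⟨fun j => (a (e j)).1, fun j => (a (e j)).2, fun h0 => ?_⟩
  have hli' : LinearIndependent ℝ ((A.submatrix (fun j => (a (e j)).1) id).map
      (Int.cast : ℤ → ℝ)).row := hli.comp e e.injective
  rw [Matrix.linearIndependent_rows_iff_isUnit, Matrix.isUnit_iff_isUnit_det] at hli'
  have h1 : ((A.submatrix (fun j => (a (e j)).1) id).map (Int.cast : ℤ → ℝ)).det = 0 := by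
    have := (Int.castRingHom ℝ).map_det (A.submatrix (fun j => (a (e j)).1) id)
    rw [h0, map_zero] at this
    exact this.symm
  rw [h1] at hli'
  exact not_isUnit_zero hli'

/-- Cramer's rule for a row selection. -/
lemma det_mul_eq_sum_adjugate (f : Fin n → Fin m) (w : Fin n → ℝ) (k : Fin n) :
    ((A.submatrix f id).det : ℝ) * w k =
      ∑ j, ((A.submatrix f id).adjugate k j : ℝ) * row A (f j) w := by
  have h := Matrix.adjugate_mul (A.submatrix f id)
  have h2 : ∀ l, ∑ j, (A.submatrix f id).adjugate k j * A (f j) l =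
      (A.submatrix f id).det * (if k = l then 1 else 0) := fun l => by
    have := congrFun (congrFun h k) l
    simpa [Matrix.mul_apply, Matrix.one_apply] using this
  simp only [row_apply, mul_sum]
  rw [sum_comm]
  have h3 : ∀ l, ∑ j, ((A.submatrix f id).adjugate k j : ℝ) * ((A (f j) l : ℝ) * w l) =
      ((A.submatrix f id).det : ℝ) * (if k = l then 1 else 0) * w l := fun l => by
    have := congrArg (Int.cast : ℤ → ℝ) (h2 l)
    rw [Int.cast_sum, Int.cast_mul] at this
    simp only [Int.cast_mul, Int.cast_ite, Int.cast_one, Int.cast_zero] at this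
    rw [← this, sum_mul]
    exact sum_congr rfl fun j _ => by ring
  rw [sum_congr rfl fun l _ => h3 l]
  simp

/-- Cramer's rule, where integrality makes the denominator at least 1 in absolute value. -/
lemma abs_le_of_abs_row_le {f : Fin n → Fin m} (hf : (A.submatrix f id).det ≠ 0) {w : Fin n → ℝ}
    {D : ℝ} (hw : ∀ j, |row A (f j) w| ≤ D) (k : Fin n) : |w k| ≤ n * maxSubdet A * D := by
  have hd : (1 : ℝ) ≤ |((A.submatrix f id).det : ℝ)| := by
    exact_mod_cast Int.one_le_abs hf
  calc |w k| ≤ |((A.submatrix f id).det : ℝ)| * |w k| :=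
        le_mul_of_one_le_left (abs_nonneg _) hd
    _ = |∑ j, ((A.submatrix f id).adjugate k j : ℝ) * row A (f j) w| := by
        rw [← abs_mul, det_mul_eq_sum_adjugate]
    _ ≤ ∑ j, |((A.submatrix f id).adjugate k j : ℝ) * row A (f j) w| := abs_sum_le_sum_abs _ _
    _ ≤ ∑ _j : Fin n, maxSubdet A * D := by
        refine sum_le_sum fun j _ => ?_
        rw [abs_mul]
        refine mul_le_mul ?_ (hw j) (abs_nonneg _) (Nat.cast_nonneg _)
        calc |((A.submatrix f id).adjugate k j : ℝ)|
            = (((A.submatrix f id).adjugate k j).natAbs : ℝ) := by rw [Nat.cast_natAbs]; simp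
          _ ≤ _ := by exact_mod_cast natAbs_adjugate_le hf k j
    _ = n * maxSubdet A * D := by simp; ring

end Determinants

/-! ### Proximity of integer vertices to vertices of the polytope -/

section Proximity

variable {n m : ℕ} {A : Matrix (Fin m) (Fin n) ℤ}

/-- The common kernel of the rows that vanish at a point. -/
def tightKer (A : Matrix (Fin m) (Fin n) ℤ) (u : Fin n → ℝ) : Submodule ℝ (Fin n → ℝ) :=
  ⨅ i ∈ {i | row A i u = 0}, LinearMap.ker (row A i)

lemma mem_tightKer {u w : Fin n → ℝ} :
    w ∈ tightKer A u ↔ ∀ i, row A i u = 0 → row A i w = 0 := by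
  simp [tightKer]

/-- In a pointed cone cut out by rows with signs, every face contains a short integral ray. -/
lemma exists_short_ray (σ : Fin m → ℝ) (hker : ∀ w, (∀ i, row A i w = 0) → w = 0)
    (u : Fin n → ℝ) (hu : ∀ i, 0 ≤ σ i * row A i u) (hσ : ∀ i, σ i ≠ 0) (hu0 : u ≠ 0) :
    ∃ g : Fin n → ℤ, g ≠ 0 ∧ (∀ k, (g k).natAbs ≤ maxSubdet A) ∧
      (∀ i, 0 ≤ σ i * row A i (intVec g)) ∧ ∀ i, row A i u = 0 → row A i (intVec g) = 0 := by
  classical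
  let T : (Fin n → ℝ) → Finset (Fin m) := fun w => {i | row A i w = 0}
  have hT : ∀ w i, i ∈ T w ↔ row A i w = 0 := fun w i => by simp [T]
  -- a point of the face with as many vanishing rows as possible
  obtain ⟨s, hs⟩ := (Set.toFinite {s : Finset (Fin m) | ∃ w, w ≠ 0 ∧
    (∀ i, 0 ≤ σ i * row A i w) ∧ T u ⊆ T w ∧ T w = s}).exists_maximal
      ⟨T u, u, hu0, hu, subset_rfl, rfl⟩
  obtain ⟨w, hw0, hw, huw, rfl⟩ := hs.prop
  have hex : ∃ i, row A i w ≠ 0 := by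
    by_contra h
    push Not at h
    exact hw0 (hker w h)
  have hpos : ∀ i, row A i w ≠ 0 → 0 < σ i * row A i w := fun i hi =>
    lt_of_le_of_ne (hw i) (mul_ne_zero (hσ i) hi).symm
  -- `w` spans an extreme ray: with `ρ` the largest ratio of row values, `ρ • w - y` stays in the
  -- cone and vanishes on the further row `i₀`, which maximality forbids unless it is zero.
  have hspan : ∀ y, (∀ i ∈ T w, row A i y = 0) → ∃ ρ : ℝ, y = ρ • w := by
    intro y hy
    obtain ⟨i₀, hi₀, hmax⟩ := exists_max_image {i | row A i w ≠ 0}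
      (fun i => σ i * row A i y / (σ i * row A i w)) (by simpa [Finset.Nonempty] using hex)
    simp only [mem_filter, mem_univ, true_and] at hi₀ hmax
    set ρ := σ i₀ * row A i₀ y / (σ i₀ * row A i₀ w)
    refine ⟨ρ, ?_⟩
    by_contra hne
    have h0 : ρ • w - y ≠ 0 := fun h => hne (sub_eq_zero.1 h).symm
    have hz : ∀ i ∈ T w, row A i (ρ • w - y) = 0 := fun i hi => by
      simp [hy i hi, (hT w i).1 hi]
    have hsub : T w ⊆ T (ρ • w - y) := fun i hi => (hT _ i).2 (hz i hi)
    have := hs.le_of_ge (y := T (ρ • w - y)) ⟨ρ • w - y, h0, fun i => ?_, huw.trans hsub, rfl⟩ hsub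
    · have h1 : i₀ ∈ T (ρ • w - y) := by
        rw [hT, map_sub, map_smul, smul_eq_mul, sub_eq_zero]
        have := hσ i₀
        simp only [ρ]
        field_simp
      exact hi₀ ((hT w i₀).1 (this h1))
    · by_cases hi : row A i w = 0
      · rw [hz i ((hT w i).2 hi), mul_zero]
      · have := (div_le_iff₀ (hpos i hi)).1 (hmax i hi)
        simp only [map_sub, map_smul, smul_eq_mul]
        linarith
  obtain ⟨i₀, hi₀⟩ := hex
  obtain ⟨f, hf, hdet⟩ := exists_submatrix_det_ne_zero (A := A) (insert i₀ (T w : Set (Fin m)))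
    fun y hy => by
      obtain ⟨ρ, rfl⟩ := hspan y fun i hi => hy i (Set.mem_insert_of_mem _ hi)
      have := hy i₀ (Set.mem_insert _ _)
      simp only [map_smul, smul_eq_mul, mul_eq_zero, hi₀, or_false] at this
      simp [this]
  have hker' : ∀ y, (∀ j, row A (f j) y = 0) → y = 0 := fun y hy => by
    ext k
    have := abs_le_of_abs_row_le hdet (w := y) (D := 0) (fun j => by simp [hy j]) k
    simpa using this
  obtain ⟨k₀, hk₀⟩ : ∃ k, f k = i₀ := by
    by_contra h
    push Not at h
    exact hw0 (hker' w fun j => (hT w _).1 (by simpa using (hf j).resolve_left (h j)))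
  have hinj : Function.Injective f := fun j k hjk => by
    by_contra hne
    exact hdet (Matrix.det_zero_of_row_eq hne (by ext l; simp [hjk]))
  -- This adjugate column is annihilated by every selected row but `i₀`, so it spans the ray,
  -- possibly with the wrong sign.
  set g : Fin n → ℤ := fun k => (A.submatrix f id).adjugate k k₀
  have hg : ∀ j, row A (f j) (intVec g) =
      if j = k₀ then ((A.submatrix f id).det : ℝ) else 0 := fun j => by
    have := congrFun (congrFun (Matrix.mul_adjugate (A.submatrix f id)) j) k₀
    rw [row_intVec]
    rw [Matrix.mul_apply] at this
    change (∑ k, A (f j) k * g k) = _ at this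
    rw [this]
    by_cases h : j = k₀ <;> simp [h]
  have hd : ((A.submatrix f id).det : ℝ) ≠ 0 := by exact_mod_cast hdet
  -- the ray is a nonzero multiple of the chosen point
  obtain ⟨c, hc⟩ : ∃ c : ℝ, intVec g = c • w := by
    refine ⟨(A.submatrix f id).det / row A i₀ w, sub_eq_zero.1 (hker' _ fun j => ?_)⟩
    rw [map_sub, map_smul, hg, smul_eq_mul]
    split_ifs with h
    · rw [h, hk₀]; field_simp; simp
    · have h1 : f j ≠ i₀ := fun h2 => h (hinj (h2.trans hk₀.symm))
      have := (hT w _).1 (by simpa using (hf j).resolve_left h1)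
      simp [this]
  have hc0 : c ≠ 0 := by
    rintro rfl
    have := hg k₀
    rw [hc] at this
    simp only [zero_smul, map_zero, if_true] at this
    exact hd this.symm
  have hg0 : g ≠ 0 := fun h => by
    have h1 : intVec g = 0 := by ext k; simp [intVec, h]
    rw [hc] at h1
    exact (smul_ne_zero hc0 hw0) h1
  have hzero : ∀ i, row A i u = 0 → row A i w = 0 := fun i hi => (hT w i).1 (huw ((hT u i).2 hi))
  rcases lt_or_gt_of_ne hc0 with hneg | hpos'
  · have hm : intVec (-g) = (-c) • w := by
      rw [neg_smul, ← hc]; ext k; simp [intVec]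
    refine ⟨-g, neg_ne_zero.2 hg0, fun k => ?_, fun i => ?_, fun i hi => ?_⟩
    · simpa using natAbs_adjugate_le hdet k k₀
    · rw [hm, map_smul, smul_eq_mul, mul_left_comm]
      exact mul_nonneg (by linarith) (hw i)
    · rw [hm, map_smul, hzero i hi, smul_zero]
  · refine ⟨g, hg0, fun k => natAbs_adjugate_le hdet k k₀, fun i => ?_, fun i hi => ?_⟩
    · rw [hc, map_smul, smul_eq_mul, mul_left_comm]
      exact mul_nonneg hpos'.le (hw i)
    · rw [hc, map_smul, hzero i hi, smul_zero]

/-- A point of a pointed cone from which no short integral ray can be subtracted is short. -/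
lemma abs_le_of_no_short_ray (σ : Fin m → ℝ) (hσ : ∀ i, σ i ≠ 0)
    (hker : ∀ w, (∀ i, row A i w = 0) → w = 0) (d : ℕ) :
    ∀ u : Fin n → ℝ, Module.finrank ℝ (tightKer A u) ≤ d → (∀ i, 0 ≤ σ i * row A i u) →
      (∀ g : Fin n → ℤ, g ≠ 0 → (∀ i, 0 ≤ σ i * row A i (intVec g)) →
        ¬ ∀ i, 0 ≤ σ i * row A i (u - intVec g)) →
      ∀ k, |u k| ≤ d * maxSubdet A := by
  -- Induction on the dimension of the face of `u`: removing as much of a short ray as the cone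
  -- permits lowers it, and the coefficient is below 1 since `u - intVec g` is outside the cone.
  induction d with
  | zero =>
    intro u hd _ _ k
    have h1 : tightKer A u = ⊥ := Submodule.finrank_eq_zero.1 (Nat.le_zero.1 hd)
    have h2 : u ∈ tightKer A u := mem_tightKer.2 fun i hi => hi
    rw [h1, Submodule.mem_bot] at h2
    simp [h2]
  | succ d ih =>
    intro u hd hu hno k
    by_cases hu0 : u = 0
    · rw [hu0]; simp only [Pi.zero_apply, abs_zero]; positivity
    obtain ⟨g, hg0, hgle, hgC, hgT⟩ := exists_short_ray σ hker u hu hσ hu0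
    have hgv : intVec g ≠ 0 := fun h => hg0 (by
      ext l; have := congrFun h l; simpa [intVec] using this)
    have hex : ∃ i, row A i (intVec g) ≠ 0 := by
      by_contra h
      push Not at h
      exact hgv (hker _ h)
    have hpos : ∀ i, row A i (intVec g) ≠ 0 → 0 < σ i * row A i (intVec g) := fun i hi =>
      lt_of_le_of_ne (hgC i) (mul_ne_zero (hσ i) hi).symm
    obtain ⟨i₀, hi₀, hmin⟩ := exists_min_image {i | row A i (intVec g) ≠ 0}
      (fun i => σ i * row A i u / (σ i * row A i (intVec g)))
      (by simpa [Finset.Nonempty] using hex)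
    simp only [mem_filter, mem_univ, true_and] at hi₀ hmin
    set t := σ i₀ * row A i₀ u / (σ i₀ * row A i₀ (intVec g)) with ht
    have ht0 : 0 ≤ t := div_nonneg (hu i₀) (hgC i₀)
    have hC : ∀ i, 0 ≤ σ i * row A i (u - t • intVec g) := fun i => by
      by_cases hi : row A i (intVec g) = 0
      · simpa [hi] using hu i
      · have := (le_div_iff₀ (hpos i hi)).1 (hmin i hi)
        simp only [map_sub, map_smul, smul_eq_mul]
        linarith
    have ht1 : t < 1 := by
      by_contra h
      push Not at h
      refine hno g hg0 hgC fun i => ?_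
      have h1 := hC i
      have h2 := mul_nonneg (sub_nonneg.2 h) (hgC i)
      simp only [map_sub, map_smul, smul_eq_mul] at h1 ⊢
      linarith
    have hlt : tightKer A (u - t • intVec g) < tightKer A u := by
      refine lt_of_le_of_ne (fun w hw => mem_tightKer.2 fun i hi => mem_tightKer.1 hw i ?_)
        fun h => ?_
      · simp [hi, hgT i hi]
      · have h1 : intVec g ∈ tightKer A u := mem_tightKer.2 hgT
        rw [← h, mem_tightKer] at h1
        refine hi₀ (h1 i₀ ?_)
        have := hσ i₀
        rw [map_sub, map_smul, smul_eq_mul, sub_eq_zero, ht]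
        field_simp
    have hrec := ih (u - t • intVec g)
      (Nat.lt_succ_iff.1 ((Submodule.finrank_lt_finrank_of_lt hlt).trans_le hd)) hC
      (fun g' hg'0 hg'C hg' => hno g' hg'0 hg'C fun i => by
        have h1 := hg' i
        have h2 := mul_nonneg ht0 (hgC i)
        simp only [map_sub, map_smul, smul_eq_mul] at h1 ⊢
        linarith) k
    have hgk : |(g k : ℝ)| ≤ maxSubdet A := by
      calc |(g k : ℝ)| = ((g k).natAbs : ℝ) := by rw [Nat.cast_natAbs]; simp
        _ ≤ _ := by exact_mod_cast hgle k
    have h3 : u k = (u - t • intVec g) k + t * g k := by simp [intVec]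
    calc |u k| ≤ |(u - t • intVec g) k| + |t * g k| := by rw [h3]; exact abs_add_le _ _
      _ ≤ d * maxSubdet A + 1 * maxSubdet A := by
          refine add_le_add hrec ?_
          rw [abs_mul, abs_of_nonneg ht0]
          exact mul_le_mul ht1.le hgk (abs_nonneg _) zero_le_one
      _ = ((d + 1 : ℕ) : ℝ) * maxSubdet A := by push_cast; ring

variable {b : Fin m → ℝ}

/-- Proximity of the vertices of the integer hull to the vertices of the polytope. -/
lemma exists_vert_near (hb : Bornology.IsBounded (polyhedron A b)) {v : Fin n → ℝ}
    (hv : v ∈ vert (integerHull (polyhedron A b))) :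
    ∃ x ∈ vert (polyhedron A b), ∀ k, |v k - x k| ≤ (n : ℝ) * maxSubdet A := by
  set P := polyhedron A b
  have hvP := vert_integerHull_subset _ hv
  -- Separating `v` from the hull of the other lattice points makes it the unique minimizer of some
  -- `f` among them; `x` will be a vertex of the face of `P` where `f` is minimal.
  have hfin : ((P ∩ lattice n) \ {v}).Finite := (finite_inter_lattice hb).subset Set.sdiff_subset
  have hnot : v ∉ convexHull ℝ ((P ∩ lattice n) \ {v}) := fun h => by
    have h1 := (convex_convexHull ℝ (P ∩ lattice n)).mem_extremePoints_iff_mem_sdiff_convexHull_sdiff.1 hv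
    exact h1.2 (convexHull_mono (Set.sdiff_subset_sdiff_left (subset_convexHull ℝ _)) h)
  obtain ⟨f, c, hfc, hfz⟩ := geometric_hahn_banach_point_closed (E := Fin n → ℝ) (convex_convexHull ℝ _)
    (hfin.isClosed_convexHull ℝ) hnot
  have huniq : ∀ z ∈ P ∩ lattice n, f z ≤ f v → z = v := fun z hz hle => by
    by_contra hne
    have := hfz z (subset_convexHull ℝ _ ⟨hz, hne⟩)
    linarith
  have hcomp : IsCompact P := Metric.isCompact_of_isClosed_isBounded isClosed_polyhedron hb
  set F : Set (Fin n → ℝ) := {x ∈ P | ∀ y ∈ P, (-f) y ≤ (-f) x}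
  have hF : IsExposed ℝ P F := fun _ => ⟨-f, rfl⟩
  obtain ⟨x₀, hx₀, hmin⟩ := hcomp.exists_isMinOn ⟨v, hvP.1⟩ f.continuous.continuousOn
  have hFne : F.Nonempty := ⟨x₀, hx₀, fun y hy => by simpa using hmin hy⟩
  obtain ⟨x, hx⟩ := (hF.isCompact hcomp).extremePoints_nonempty hFne
  have hxv : x ∈ vert P := hF.isExtreme.extremePoints_subset_extremePoints hx
  have hxmin : ∀ y ∈ P, f x ≤ f y := fun y hy => by simpa using hx.1.2 y hy
  refine ⟨x, hxv, fun k => ?_⟩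
  classical
  -- If `g` and `x - v - g` both lie in this cone, then `v + g` and `x - ε g` are in `P`. Minimality
  -- at `x` gives `f g ≤ 0`, so `v + g` contradicts uniqueness of `v`.
  set σ : Fin m → ℝ := fun i => if 0 ≤ row A i (x - v) then 1 else -1
  have hker := eq_zero_of_row_eq_zero hb ⟨v, hvP.1⟩
  have := abs_le_of_no_short_ray (A := A) σ (fun i => by simp only [σ]; split_ifs <;> norm_num)
    hker n (x - v) ((Submodule.finrank_le _).trans (by simp)) (fun i => by
      simp only [σ]; split_ifs with h
      · simpa using h
      · push Not at h; linarith) (fun g hg0 hgC hg => ?_) k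
  · rwa [Pi.sub_apply, abs_sub_comm] at this
  have hmem : v + intVec g ∈ P := fun i => by
    rw [← row_apply, map_add]
    have h1 := hgC i
    have h2 := hg i
    have h3 := mem_polyhedron.1 hvP.1 i
    have h4 := mem_polyhedron.1 hxv.1 i
    simp only [σ] at h1 h2
    split_ifs at h1 h2 with h
    · simp only [map_sub] at h2; linarith
    · linarith
  have hfg : f (intVec g) ≤ 0 := by
    obtain ⟨ε, hε, h1⟩ := exists_pos_add_smul_mem hxv.1 (-intVec g) fun i hi => by
      have h1 := hgC i
      have h3 := mem_polyhedron.1 hvP.1 i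
      have h5 : 0 ≤ row A i (x - v) := by rw [map_sub]; linarith
      simp only [σ, if_pos h5] at h1
      rw [map_neg]; linarith
    have h2 := hxmin _ h1
    simp only [map_add, map_smul, map_neg, smul_eq_mul] at h2
    nlinarith
  have := huniq _ ⟨hmem, add_intVec_mem_lattice hvP.2 g⟩ (by rw [map_add]; linarith)
  have h1 : intVec g = 0 := by simpa using this
  exact hg0 (by ext l; have := congrFun h1 l; simpa [intVec] using this)

end Proximity

/-! ### Sign patterns via VC dimension -/

section Patterns

lemma sum_choose_le_pow (N d : ℕ) : ∑ k ∈ Iic d, N.choose k ≤ (N + 1) ^ d := by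
  rw [add_pow, ← Nat.range_succ_eq_Iic]
  refine sum_le_sum fun k hk => ?_
  have h1 : 0 < d.choose k := Nat.choose_pos (by simpa [Nat.lt_succ_iff] using hk)
  calc N.choose k ≤ N ^ k := Nat.choose_le_pow N k
    _ ≤ N ^ k * 1 ^ (d - k) * d.choose k := by
      rw [one_pow, mul_one]; exact Nat.le_mul_of_pos_right _ h1

/-- Sign patterns of finitely many affine functionals on a hyperplane. -/
lemma card_patterns_le {E κ : Type} [AddCommGroup E] [Module ℝ E] [FiniteDimensional ℝ E]
    [Fintype κ] [DecidableEq κ] (l : κ → E →ₗ[ℝ] ℝ) (t : κ → ℝ) (h : E →ₗ[ℝ] ℝ) (hh : h ≠ 0)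
    (β : ℝ) (𝒜 : Finset (Finset κ))
    (h𝒜 : ∀ s ∈ 𝒜, ∃ x, h x = β ∧ ∀ q, q ∈ s ↔ l q x ≤ t q) :
    𝒜.card ≤ (Fintype.card κ + 1) ^ (Module.finrank ℝ E - 1) := by
  have hvc : 𝒜.vcDim ≤ Module.finrank ℝ E - 1 := by
    refine Finset.sup_le fun s hs => ?_
    rw [mem_shatterer] at hs
    by_contra hcard
    -- A larger shattered set, together with `h`, has more functionals than the dual has dimensions.
    have hdep : ¬ LinearIndependent ℝ
        (fun o : Option s => o.elim h fun q => l q : Option s → Module.Dual ℝ E) := fun hli => by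
      have := hli.fintype_card_le_finrank
      rw [Subspace.dual_finrank_eq] at this
      simp only [Fintype.card_option, Fintype.card_coe] at this
      omega
    obtain ⟨c, hc, o, ho⟩ := Fintype.not_linearIndependent_iff.1 hdep
    rw [Fintype.sum_option] at hc
    have hval : ∀ x, h x = β → ∑ q : s, c (some q) * l q x = -(c none * β) := fun x hx => by
      have := LinearMap.congr_fun hc x
      simp only [Option.elim, LinearMap.add_apply, LinearMap.smul_apply, LinearMap.sum_apply,
        smul_eq_mul, LinearMap.zero_apply, hx] at this
      linarith
    obtain ⟨q₀, hq₀⟩ : ∃ q, c (some q) ≠ 0 := by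
      by_contra hall
      push Not at hall
      simp only [Option.elim, hall, zero_smul, sum_const_zero, add_zero] at hc
      have h0 := (smul_eq_zero.1 hc).resolve_right hh
      cases o with
      | none => exact ho h0
      | some q => exact ho (hall q)
    have key : ∀ u : Finset κ, u ⊆ s → ∃ x, h x = β ∧ ∀ q : s, q.1 ∈ u ↔ l q x ≤ t q := by
      intro u hu
      obtain ⟨a, ha, hau⟩ := hs hu
      obtain ⟨x, hx, hxq⟩ := h𝒜 a ha
      refine ⟨x, hx, fun q => ?_⟩
      rw [← hxq, ← hau, mem_inter]
      simp
    -- `x` puts each term of the dependence above its threshold and `y` below, although the sum is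
    -- constant on the hyperplane.
    obtain ⟨x, hx, hxq⟩ := key {q ∈ s | ∃ hq : q ∈ s, c (some ⟨q, hq⟩) ≤ 0} (filter_subset _ _)
    obtain ⟨y, hy, hyq⟩ := key {q ∈ s | ∃ hq : q ∈ s, 0 ≤ c (some ⟨q, hq⟩)} (filter_subset _ _)
    have hx' : ∀ q : s, c (some q) ≤ 0 ↔ l q x ≤ t q := fun q => by
      rw [← hxq]; simp
    have hy' : ∀ q : s, 0 ≤ c (some q) ↔ l q y ≤ t q := fun q => by
      rw [← hyq]; simp
    have hle : ∀ q : s, c (some q) * l q y ≤ c (some q) * l q x ∧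
        (c (some q) ≠ 0 → c (some q) * l q y < c (some q) * l q x) := fun q => by
      rcases lt_trichotomy (c (some q)) 0 with hq | hq | hq
      · have h1 := (hx' q).1 hq.le
        have h2 := lt_of_not_ge fun h => absurd ((hy' q).2 h) (not_le.2 hq)
        have := mul_lt_mul_of_neg_left (h1.trans_lt h2) hq
        exact ⟨this.le, fun _ => this⟩
      · simp [hq]
      · have h1 := (hy' q).1 hq.le
        have h2 := lt_of_not_ge fun h => absurd ((hx' q).2 h) (not_le.2 hq)
        have := mul_lt_mul_of_pos_left (h1.trans_lt h2) hq
        exact ⟨this.le, fun _ => this⟩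
    have := sum_lt_sum (s := univ) (fun q _ => (hle q).1) ⟨q₀, mem_univ _, (hle q₀).2 hq₀⟩
    rw [hval x hx, hval y hy] at this
    exact lt_irrefl _ this
  calc 𝒜.card ≤ 𝒜.shatterer.card := card_le_card_shatterer 𝒜
    _ ≤ ∑ k ∈ Iic 𝒜.vcDim, (Fintype.card κ).choose k := card_shatterer_le_sum_vcDim
    _ ≤ (Fintype.card κ + 1) ^ 𝒜.vcDim := sum_choose_le_pow _ _
    _ ≤ _ := Nat.pow_le_pow_right (Nat.succ_pos _) hvc

end Patterns

/-! ### A deep center and central projection -/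

section Center

variable {n m : ℕ} {A : Matrix (Fin m) (Fin n) ℤ} {b : Fin m → ℝ}

/-- A point of a polytope whose slacks are at least a fixed fraction of the maximal slacks. -/
lemma exists_center (hb : Bornology.IsBounded (polyhedron A b)) (hne : (polyhedron A b).Nonempty) :
    ∃ c ∈ polyhedron A b, ∀ i, ∀ x ∈ polyhedron A b,
      b i - row A i x ≤ (n + 1) * (b i - row A i c) := by
  set P := polyhedron A b
  have hcomp : IsCompact P := Metric.isCompact_of_isClosed_isBounded isClosed_polyhedron hb
  choose y hyP hy using fun i => hcomp.exists_isMinOn hne (continuous_row (A := A) i).continuousOn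
  let F : Fin m → Set (Fin n → ℝ) := fun i =>
    P ∩ {c | row A i c ≤ b i - (b i - row A i (y i)) / (n + 1)}
  obtain ⟨x₀, hx₀⟩ := hne
  have hn : (0 : ℝ) < n + 1 := by positivity
  -- An average of `n + 1` points of `P` keeps a fraction `1/(n+1)` of each point's slack, in
  -- particular of the maximal slack of each row in `I`.
  have hpoint : ∀ I : Finset (Fin m), I.card ≤ n + 1 → ∃ c ∈ P, ∀ i ∈ I,
      row A i c ≤ b i - (b i - row A i (y i)) / (n + 1) := by
    intro I hI
    have hI' : (I.card : ℝ) ≤ n + 1 := by exact_mod_cast hI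
    -- average of the minimizers, padded with a fixed point
    set c := (1 / ((n : ℝ) + 1)) • ((n + 1 - I.card : ℝ) • x₀ + ∑ j ∈ I, y j)
    have hval : ∀ i, (n + 1) * (b i - row A i c) =
        (n + 1 - I.card : ℝ) * (b i - row A i x₀) + ∑ j ∈ I, (b i - row A i (y j)) := fun i => by
      simp only [c, map_smul, map_add, map_sum, smul_eq_mul, sum_sub_distrib, sum_const,
        nsmul_eq_mul]
      field_simp
      ring
    have h0 : ∀ i, 0 ≤ (n + 1 - I.card : ℝ) * (b i - row A i x₀) := fun i =>
      mul_nonneg (by linarith) (sub_nonneg.2 (hx₀ i))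
    have h1 : ∀ i j, 0 ≤ b i - row A i (y j) := fun i j => sub_nonneg.2 (hyP j i)
    refine ⟨c, fun i => ?_, fun i hi => ?_⟩
    · rw [← row_apply]
      have h2 : 0 ≤ (n + 1) * (b i - row A i c) := by
        rw [hval]; exact add_nonneg (h0 i) (sum_nonneg fun j _ => h1 i j)
      have := nonneg_of_mul_nonneg_right h2 hn
      linarith
    · have h2 : b i - row A i (y i) ≤ (n + 1) * (b i - row A i c) := by
        rw [hval]
        have := single_le_sum (f := fun j => b i - row A i (y j)) (fun j _ => h1 i j) hi
        have := h0 i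
        linarith
      have := (div_le_iff₀' hn).2 h2
      linarith
  have hF : (⋂ i ∈ (univ : Finset (Fin m)), F i).Nonempty := by
    refine Convex.helly_theorem' (𝕜 := ℝ) (fun i _ => convex_polyhedron.inter
      (convex_halfSpace_le (row A i).isLinear _)) fun I _ hI => ?_
    obtain ⟨c, hc, hcI⟩ := hpoint I (by simpa using hI)
    exact ⟨c, by simpa [F] using fun i hi => ⟨hc, hcI i hi⟩⟩
  obtain ⟨c, hc⟩ := hF
  simp only [mem_univ, Set.iInter_true, Set.mem_iInter] at hc
  have hcv : ∀ i, ∀ x ∈ P, b i - row A i x ≤ (n + 1) * (b i - row A i c) := fun i x hx => by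
    have h1 : row A i (y i) ≤ row A i x := hy i hx
    have h2 : row A i c ≤ b i - (b i - row A i (y i)) / (n + 1) := (hc i).2
    have h3 : (b i - row A i (y i)) / (n + 1) ≤ b i - row A i c := by linarith
    have := (div_le_iff₀' hn).1 h3
    linarith
  refine ⟨c, fun i => ?_, hcv⟩
  rw [← row_apply]
  have h2 : 0 ≤ (n + 1) * (b i - row A i c) := (sub_nonneg.2 (hx₀ i)).trans (hcv i x₀ hx₀)
  have := nonneg_of_mul_nonneg_right h2 hn
  linarith

/-- Central projection of a point to the boundary of a polyhedron. -/
lemma exists_projection {c u : Fin n → ℝ} (hc : c ∈ polyhedron A b) (hu : u ∈ polyhedron A b)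
    {R : ℝ} (hR : 0 ≤ R) (hnot : c + R • (u - c) ∉ polyhedron A b) :
    ∃ r : ℝ, 1 ≤ r ∧ r < R ∧ c + r • (u - c) ∈ polyhedron A b ∧
      ∃ j, row A j ≠ 0 ∧ row A j (c + r • (u - c)) = b j := by
  simp only [mem_polyhedron, not_forall, not_le, map_add, map_smul, smul_eq_mul] at hnot
  obtain ⟨i₁, hi₁⟩ := hnot
  have hc' := mem_polyhedron.1 hc
  have hpos : 0 < row A i₁ (u - c) := by
    by_contra h
    push Not at h
    have := mul_nonpos_of_nonneg_of_nonpos hR h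
    linarith [hc' i₁]
  -- `j` is the first row to become tight along the ray.
  obtain ⟨j, hj, hmin⟩ := exists_min_image {i | 0 < row A i (u - c)}
    (fun i => (b i - row A i c) / row A i (u - c)) ⟨i₁, by simpa using hpos⟩
  simp only [mem_filter, mem_univ, true_and] at hj hmin
  refine ⟨(b j - row A j c) / row A j (u - c), ?_, ?_, ?_, j, ?_, ?_⟩
  · rw [one_le_div hj, map_sub]
    linarith [mem_polyhedron.1 hu j]
  · refine (hmin i₁ hpos).trans_lt ?_
    rw [div_lt_iff₀ hpos]
    linarith
  · intro i
    rw [← row_apply, map_add, map_smul, smul_eq_mul]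
    rcases lt_or_ge 0 (row A i (u - c)) with hi | hi
    · have := (le_div_iff₀ hi).1 (hmin i hi)
      linarith
    · have h1 : 0 ≤ (b j - row A j c) / row A j (u - c) :=
        div_nonneg (by linarith [hc' j]) hj.le
      have := mul_nonpos_of_nonneg_of_nonpos h1 hi
      linarith [hc' i]
  · intro h
    rw [h] at hj
    simp at hj
  · rw [map_add, map_smul, smul_eq_mul, div_mul_cancel₀ _ hj.ne']
    ring

end Center

/-! ### Slack levels and the count of classes -/

section Counting

variable {n m : ℕ} {A : Matrix (Fin m) (Fin n) ℤ} {b : Fin m → ℝ}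

/-- The geometric scale of slack levels. -/
noncomputable def level (k : ℕ) : ℝ := 1 / 2 * (3 / 2) ^ k

/-- Two numbers on the same side of all levels up to `T` are both small, comparable, or both
large. -/
lemma level_comparison {T : ℕ} {p q : ℝ} (h : ∀ k ≤ T, p ≤ level k ↔ q ≤ level k) :
    (p ≤ 1 / 2 ∧ q ≤ 1 / 2) ∨ (p ≤ 3 / 2 * q ∧ q ≤ 3 / 2 * p) ∨
      (level T < p ∧ level T < q) := by
  classical
  by_cases hT : p ≤ level T
  · obtain ⟨k, hk, hmin⟩ : ∃ k, p ≤ level k ∧ ∀ l < k, ¬ p ≤ level l :=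
      ⟨Nat.find ⟨T, hT⟩, Nat.find_spec (⟨T, hT⟩ : ∃ k, p ≤ level k), fun l hl => Nat.find_min _ hl⟩
    have hkT : k ≤ T := not_lt.1 fun hlt => hmin T hlt hT
    have hq := (h k hkT).1 hk
    obtain _ | k := k
    · left
      simp only [level, pow_zero, mul_one] at hk hq
      exact ⟨hk, hq⟩
    · right; left
      have h1 := hmin k (Nat.lt_succ_self k)
      have h2 : ¬ q ≤ level k := fun h3 => h1 ((h k (by omega)).2 h3)
      have h3 : level (k + 1) = 3 / 2 * level k := by simp only [level, pow_succ]; ring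
      rw [h3] at hk hq
      push Not at h1 h2
      constructor <;> linarith
  · right; right
    refine ⟨not_le.1 hT, not_le.1 fun hq => hT ((h T le_rfl).2 hq)⟩

/-- Comparison of slacks along two rays with a common origin. -/
lemma slack_le_two_mul {r r' p p' s s' c : ℝ} {z : ℤ} (hr : 1 ≤ r) (hrr : r ≤ r')
    (hr4 : 3 * r' ≤ 4 * r) (hs : r * s = p + (r - 1) * c) (hs' : r' * s' = p' + (r' - 1) * c)
    (hp' : 0 ≤ p') (hp : 0 ≤ p) (hc : 0 ≤ c) (hs'0 : 0 ≤ s') (hz : s = z)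
    (h : p ≤ 1 / 2 ∨ p ≤ 3 / 2 * p') : s ≤ 2 * s' := by
  have hr0 : 0 < r := by linarith
  have hr'0 : 0 < r' := by linarith
  -- The contribution `(1 - 1/r) c` of the center increases with `r`.
  have hcc : (r - 1) * c * r' ≤ (r' - 1) * c * r := by
    nlinarith [mul_nonneg (sub_nonneg.2 hrr) hc]
  rcases h with h | h
  · have h1 : s ≤ s' + 1 / 2 := by
      have h2 : r * r' * s ≤ r * r' * (s' + 1 / 2) := by
        have e1 : r * r' * s = r' * p + (r - 1) * c * r' := by linear_combination r' * hs
        have e2 : r * r' * s' = r * p' + (r' - 1) * c * r := by linear_combination r * hs'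
        have e3 : r' * p ≤ r' * (1 / 2) := mul_le_mul_of_nonneg_left h hr'0.le
        have e4 : r' * (1 / 2) ≤ r * r' * (1 / 2) := by nlinarith
        have e5 := mul_nonneg hr0.le hp'
        linarith
      exact le_of_mul_le_mul_left h2 (by positivity)
    -- Integrality enters here: a positive `s` is at least 1, so `s' ≥ s - 1/2 ≥ s / 2`. Hence the
    -- lowest level 1/2.
    rcases le_or_gt z 0 with hz0 | hz0
    · have : (z : ℝ) ≤ 0 := by exact_mod_cast hz0
      linarith
    · have : (1 : ℝ) ≤ z := by exact_mod_cast hz0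
      linarith
  -- The factor 2 is 4/3 from the dilation factors times 3/2 from the levels.
  · have h2 : r * r' * s ≤ r * r' * (2 * s') := by
      have e1 : r * r' * s = r' * p + (r - 1) * c * r' := by linear_combination r' * hs
      have e2 : r * r' * s' = r * p' + (r' - 1) * c * r := by linear_combination r * hs'
      have e3 : r' * p ≤ 4 / 3 * r * p := mul_le_mul_of_nonneg_right (by linarith) hp
      have e4 : 4 / 3 * r * p ≤ 4 / 3 * r * (3 / 2 * p') :=
        mul_le_mul_of_nonneg_left h (by positivity)
      have e5 : 0 ≤ (r' - 1) * c * r := by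
        have : 0 ≤ r' - 1 := by linarith
        positivity
      linarith
    exact le_of_mul_le_mul_left h2 (by positivity)

/-- Two points of a polytope in the same level class, one of which lies on a bounded ray through a
point close to a vertex, have comparable slacks. -/
lemma slack_comparison {T : ℕ} {x p q : Fin n → ℝ} (hx : x ∈ vert (polyhedron A b)) {R₂ : ℝ}
    (hR₂ : 1 ≤ R₂) (hR₂T : R₂ ≤ level T)
    (hT : 3 * (n * maxEntry A * (n * maxSubdet A * (2 * R₂))) ≤ level T)
    (hp : p ∈ polyhedron A b) (hq : q ∈ polyhedron A b)
    (htight : ∀ i, row A i x = b i → b i - row A i p ≤ R₂)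
    (hpq : ∀ i, ∀ k ≤ T, b i - row A i p ≤ level k ↔ b i - row A i q ≤ level k) (i : Fin m) :
    (b i - row A i p ≤ 1 / 2 ∧ b i - row A i q ≤ 1 / 2) ∨
      (b i - row A i p ≤ 3 / 2 * (b i - row A i q) ∧
        b i - row A i q ≤ 3 / 2 * (b i - row A i p)) := by
  have hp' := fun i => sub_nonneg.2 (mem_polyhedron.1 hp i)
  have hq' := fun i => sub_nonneg.2 (mem_polyhedron.1 hq i)
  rcases level_comparison (hpq i) with h | h | ⟨h1, h2⟩
  · exact Or.inl h
  · exact Or.inr h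
  right
  -- Above the top level, rows tight at `x` bound `p - q`; by `hT` the two slacks then differ by at
  -- most a third of `level T`, hence by a factor at most 4/3.
  obtain ⟨f, hf, hdet⟩ := exists_submatrix_det_ne_zero (A := A) {i | row A i x = b i}
    (fun w hw => eq_zero_of_tight hx w hw)
  have hw : ∀ j, |row A (f j) (p - q)| ≤ 2 * R₂ := fun j => by
    have h3 := htight (f j) (hf j)
    have h4 : b (f j) - row A (f j) q ≤ 2 * R₂ := by
      rcases level_comparison (hpq (f j)) with h | h | h <;> linarith [h.1, h.2]
    rw [map_sub, abs_le]
    constructor <;> linarith [hp' (f j), hq' (f j)]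
  have hk := fun k => abs_le_of_abs_row_le hdet hw k
  have := (abs_row_le i (abs_entry_le A i) hk)
  rw [map_sub, abs_le] at this
  constructor <;> linarith

/-- Counting the vertices of the integer hull by level classes of their central projections. -/
theorem encard_vert_integerHull_le {b : Fin m → ℤ}
    (hb : Bornology.IsBounded (polyhedron A fun i => (b i : ℝ)))
    (hne : (polyhedron A fun i => (b i : ℝ)).Nonempty) {T : ℕ}
    (h1 : (1 : ℝ) ≤ 2 * (n + 1) * (n * maxEntry A * (n * maxSubdet A)))
    (h2 : 2 * (n + 1) * (n * maxEntry A * (n * maxSubdet A)) ≤ level T)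
    (h3 : 3 * (n * maxEntry A * (n * maxSubdet A *
      (2 * (2 * (n + 1) * (n * maxEntry A * (n * maxSubdet A)))))) ≤ level T) :
    (vert (integerHull (polyhedron A fun i => (b i : ℝ)))).encard ≤
      ((6 * (n + 1) * (m * (m * (T + 1) + 1) ^ (n - 1)) + 1 : ℕ) : ℕ∞) := by
  classical
  set P := polyhedron A fun i => (b i : ℝ)
  set V := vert (integerHull P)
  set R₂ : ℝ := 2 * (n + 1) * (n * maxEntry A * (n * maxSubdet A)) with hR₂
  obtain ⟨c, hc, hcmax⟩ := exists_center hb hne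
  have hcs : ∀ i, 0 ≤ (b i : ℝ) - row A i c := fun i => sub_nonneg.2 (mem_polyhedron.1 hc i)
  have hVP : ∀ u ∈ V, u ∈ P := fun u hu => (vert_integerHull_subset _ hu).1
  set R : ℝ := 2 * (n + 1)
  have hR4 : 2 ≤ R := by simp only [R]; linarith [Nat.cast_nonneg (α := ℝ) n]
  set V₀ := {u ∈ V | c + R • (u - c) ∈ P}
  set V₁ := {u ∈ V | c + R • (u - c) ∉ P}
  have hV : V = V₁ ∪ V₀ := by
    ext u
    simp only [V₀, V₁, Set.mem_union, Set.mem_ofPred_eq]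
    tauto
  -- the slack of a point on the ray from the center
  have hray : ∀ (r : ℝ) (u : Fin n → ℝ) (i : Fin m), r * ((b i : ℝ) - row A i u) =
      ((b i : ℝ) - row A i (c + r • (u - c))) + (r - 1) * ((b i : ℝ) - row A i c) := by
    intro r u i
    simp only [map_add, map_smul, map_sub, smul_eq_mul]
    ring
  -- at most one vertex is central
  have hV₀ : V₀.encard ≤ 1 := by
    rw [Set.encard_le_one_iff]
    intro u v hu hv
    refine eq_of_slack_le_two_mul hu.1 hv.1 fun i => ?_
    -- With γ the slack of `c`, these give R s_u ≤ (3R/2 - 1)γ ≤ 2(R - 1)γ ≤ 2 R s_v, the middle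
    -- step by `R ≥ 2`.
    have e1 := hray R u i
    have e2 := hray R v i
    have e3 := hcmax i _ hu.2
    have e4 : 0 ≤ (b i : ℝ) - row A i (c + R • (v - c)) := sub_nonneg.2 (mem_polyhedron.1 hv.2 i)
    refine le_of_mul_le_mul_left (a := R) ?_ (by linarith)
    have e5 := hcs i
    rw [show (n + 1 : ℝ) = R / 2 by simp only [R]; ring] at e3
    nlinarith
  -- the classes of the other vertices
  have hproj : ∀ u : V₁, ∃ r : ℝ, 1 ≤ r ∧ r < R ∧ c + r • (u.1 - c) ∈ P ∧
      ∃ j, row A j ≠ 0 ∧ row A j (c + r • (u.1 - c)) = b j := fun u =>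
    exists_projection hc (hVP u u.2.1) (by linarith) u.2.2
  choose r hr1 hrR hrP j hj0 hj using hproj
  -- The condition that a slack is at most `level k`, with the constant moved to the right so that
  -- the left side is linear.
  let pat : (Fin n → ℝ) → Finset (Fin m × Fin (T + 1)) := fun p =>
    {q | -row A q.1 p ≤ level q.2 - b q.1}
  have hpat : ∀ p q, pat p = pat q → ∀ i, ∀ k ≤ T,
      (b i : ℝ) - row A i p ≤ level k ↔ (b i : ℝ) - row A i q ≤ level k := by
    intro p q h i k hk
    have := congrArg (fun s => (i, (⟨k, Nat.lt_succ_of_le hk⟩ : Fin (T + 1))) ∈ s) h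
    simp only [pat, mem_filter, mem_univ, true_and, eq_iff_iff] at this
    constructor <;> intro h'
    · have := this.1 (by linarith)
      linarith
    · have := this.2 (by linarith)
      linarith
  let pats : Fin m → Finset (Finset (Fin m × Fin (T + 1))) := fun i =>
    {s | row A i ≠ 0 ∧ ∃ p, row A i p = b i ∧ pat p = s}
  have hcard : ∀ i, (pats i).card ≤ (m * (T + 1) + 1) ^ (n - 1) := by
    intro i
    by_cases hi : row A i = 0
    · simp [pats, hi]
    · have := card_patterns_le (fun q : Fin m × Fin (T + 1) => -row A q.1)
        (fun q => level q.2 - b q.1) (row A i) hi (b i) (pats i) (fun s hs => by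
          simp only [pats, mem_filter, mem_univ, true_and] at hs
          obtain ⟨-, p, hp, rfl⟩ := hs
          exact ⟨p, hp, fun q => by simp [pat]⟩)
      simpa using this
  let S := range (6 * (n + 1)) ×ˢ (univ : Finset (Fin m)).sigma pats
  have hS : S.card ≤ 6 * (n + 1) * (m * (m * (T + 1) + 1) ^ (n - 1)) := by
    rw [card_product, card_range, card_sigma]
    refine Nat.mul_le_mul_left _ ((sum_le_card_nsmul _ _ _ fun i _ => hcard i).trans ?_)
    simp
  let cls : V₁ → ℕ × (Σ _ : Fin m, Finset (Fin m × Fin (T + 1))) := fun u =>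
    (⌊3 * r u⌋₊, ⟨j u, pat (c + r u • (u.1 - c))⟩)
  have hmaps : ∀ u, cls u ∈ S := fun u => by
    simp only [S, cls, mem_product, mem_range, mem_sigma, mem_univ, true_and, pats, mem_filter]
    refine ⟨?_, hj0 u, _, hj u, rfl⟩
    rw [Nat.floor_lt (by linarith [hr1 u])]
    have := hrR u
    push_cast
    simp only [R] at this
    linarith
  have hcmp : ∀ u v : V₁, cls u = cls v → r u ≤ r v → u = v := by
    intro u v huv hle
    have hfl : ⌊3 * r u⌋₊ = ⌊3 * r v⌋₊ := congrArg Prod.fst huv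
    have hpp : pat (c + r u • (u.1 - c)) = pat (c + r v • (v.1 - c)) := by
      have := congrArg (fun a => a.2.2) huv
      exact this
    -- Equal floors give `3 r v < 3 r u + 1`, and `1 ≤ r u`.
    have hr4 : 3 * r v ≤ 4 * r u := by
      have e1 := Nat.lt_floor_add_one (3 * r v)
      have e2 := Nat.floor_le (a := 3 * r u) (by linarith [hr1 u])
      rw [hfl] at e2
      linarith [hr1 u]
    obtain ⟨x, hx, hxu⟩ := exists_vert_near hb u.2.1
    -- The slack at the projection is at most `r u` times the slack at `u`, which is within `nΔ` of
    -- `x`.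
    have htight : ∀ i, row A i x = b i → (b i : ℝ) - row A i (c + r u • (u.1 - c)) ≤ R₂ := by
      intro i hi
      have e1 := hray (r u) u.1 i
      have e2 := abs_row_le i (abs_entry_le A i) (x := u.1 - x) hxu
      rw [map_sub, hi, abs_le] at e2
      have e3 : 0 ≤ (r u - 1) * ((b i : ℝ) - row A i c) :=
        mul_nonneg (by linarith [hr1 u]) (hcs i)
      have e4 : r u * ((b i : ℝ) - row A i u.1) ≤ R * (n * maxEntry A * (n * maxSubdet A)) :=
        mul_le_mul (hrR u).le (by linarith) (sub_nonneg.2 (mem_polyhedron.1 (hVP u u.2.1) i))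
          (by linarith)
      linarith
    have hsl := slack_comparison hx h1 h2 h3 (hrP u) (hrP v) htight (hpat _ _ hpp)
    refine Subtype.ext (eq_of_slack_le_two_mul u.2.1 v.2.1 fun i => ?_)
    obtain ⟨z, hz⟩ := (vert_integerHull_subset _ u.2.1).2
    refine slack_le_two_mul (z := b i - ∑ k, A i k * z k) (hr1 u) hle hr4 (hray _ _ i)
      (hray _ _ i) (sub_nonneg.2 (hrP v i)) (sub_nonneg.2 (hrP u i)) (hcs i)
      (sub_nonneg.2 (hVP v v.2.1 i)) ?_ ((hsl i).imp (fun h => h.1) fun h => h.1)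
    rw [← hz, Int.cast_sub, ← row_intVec]
    rfl
  have hinj : Function.Injective cls := fun u v huv => by
    rcases le_total (r u) (r v) with h | h
    · exact hcmp u v huv h
    · exact (hcmp v u huv.symm h).symm
  have hV₁ : V₁.encard ≤ (S.card : ℕ∞) := by
    rw [← Set.encard_coe_eq_coe_finsetCard, ← ENat.card_coe_set_eq V₁, ← Set.encard_univ]
    exact Set.encard_le_encard_of_injOn (f := cls) (fun u _ => hmaps u) hinj.injOn
  calc V.encard ≤ V₁.encard + V₀.encard := by rw [hV]; exact Set.encard_union_le _ _
    _ ≤ (S.card : ℕ∞) + 1 := add_le_add hV₁ hV₀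
    _ ≤ _ := by
      have : S.card + 1 ≤ 6 * (n + 1) * (m * (m * (T + 1) + 1) ^ (n - 1)) + 1 := by omega
      exact_mod_cast this

end Counting

/-! ### Encoding size estimates -/

section Sizes

variable {n m : ℕ} (A : Matrix (Fin m) (Fin n) ℤ)

lemma le_rowEncodingSize (i : Fin m) : n ≤ rowEncodingSize A :=
  calc n = ∑ _k : Fin n, 1 := by simp
    _ ≤ ∑ k, (1 + Nat.size (A i k).natAbs) := sum_le_sum fun k _ => Nat.le_add_right _ _
    _ ≤ _ := le_sup (f := fun i => ∑ k, (1 + Nat.size (A i k).natAbs)) (mem_univ i)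

lemma natAbs_entry_le_two_pow (i : Fin m) (k : Fin n) :
    (A i k).natAbs ≤ 2 ^ rowEncodingSize A := by
  refine (Nat.lt_size_self _).le.trans (Nat.pow_le_pow_right two_pos ?_)
  calc (A i k).natAbs.size ≤ 1 + (A i k).natAbs.size := Nat.le_add_left _ _
    _ ≤ ∑ k, (1 + Nat.size (A i k).natAbs) :=
        single_le_sum (f := fun k => 1 + Nat.size (A i k).natAbs) (fun _ _ => Nat.zero_le _)
          (mem_univ k)
    _ ≤ _ := le_sup (f := fun i => ∑ k, (1 + Nat.size (A i k).natAbs)) (mem_univ i)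

lemma maxEntry_le_two_pow : maxEntry A ≤ 2 ^ rowEncodingSize A :=
  Finset.sup_le fun i _ => Finset.sup_le fun k _ => natAbs_entry_le_two_pow A i k

/-- Leibniz expansion; the factorial is absorbed through `k ≤ n ≤ φ ≤ 2 ^ φ`. -/
lemma maxSubdet_le_two_pow (hm : 0 < m) : maxSubdet A ≤ 2 ^ (2 * n * rowEncodingSize A) := by
  set φ := rowEncodingSize A
  refine Finset.sup_le fun k hk => Finset.sup_le fun p _ => ?_
  have hkn := (mem_Icc.1 hk).2
  have hn : n ≤ φ := le_rowEncodingSize A ⟨0, hm⟩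
  have h := Matrix.det_le (A := A.submatrix p.1 p.2) (abv := AbsoluteValue.abs) (x := 2 ^ φ)
    fun i j => by
      have := natAbs_entry_le_two_pow A (p.1 i) (p.2 j)
      rw [AbsoluteValue.abs_apply, Matrix.submatrix_apply, Int.abs_eq_natAbs]
      exact_mod_cast this
  rw [AbsoluteValue.abs_apply, Int.abs_eq_natAbs, Fintype.card_fin, nsmul_eq_mul] at h
  have h' : (A.submatrix p.1 p.2).det.natAbs ≤ k.factorial * (2 ^ φ) ^ k := by exact_mod_cast h
  have hk2 : k ≤ 2 ^ φ := (hkn.trans hn).trans Nat.lt_two_pow_self.le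
  calc _ ≤ k.factorial * (2 ^ φ) ^ k := h'
    _ ≤ (2 ^ φ) ^ k * (2 ^ φ) ^ k :=
        Nat.mul_le_mul_right _ ((Nat.factorial_le_pow k).trans (Nat.pow_le_pow_left hk2 k))
    _ = 2 ^ (2 * k * φ) := by rw [← pow_mul, ← pow_add]; congr 1; ring
    _ ≤ _ := Nat.pow_le_pow_right two_pos (by gcongr)

/-- The slack bounds have logarithm of order `n φ`. -/
lemma slack_bound_le_two_pow (hn : 1 ≤ n) (hm : 0 < m) :
    12 * (n + 1) * n ^ 4 * maxEntry A ^ 2 * maxSubdet A ^ 2 ≤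
      2 ^ (15 * n * rowEncodingSize A) := by
  have hL := maxEntry_le_two_pow A
  have hD := maxSubdet_le_two_pow A hm
  have hnφ : n ≤ rowEncodingSize A := le_rowEncodingSize A ⟨0, hm⟩
  set φ := rowEncodingSize A
  have h0 : n + 1 ≤ 2 ^ φ := (Nat.succ_le_succ hnφ).trans Nat.lt_two_pow_self
  have h1 : n ≤ 2 ^ φ := (Nat.le_succ n).trans h0
  have hφ : φ ≤ n * φ := Nat.le_mul_of_pos_left _ hn
  calc _ ≤ 2 ^ 4 * 2 ^ φ * (2 ^ φ) ^ 4 * (2 ^ φ) ^ 2 * (2 ^ (2 * n * φ)) ^ 2 := by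
        gcongr; norm_num
    _ = 2 ^ (4 + 7 * φ + 4 * (n * φ)) := by ring
    _ ≤ _ := Nat.pow_le_pow_right two_pos (by nlinarith)

lemma row_slack_bound_lt_two_pow (hn : 1 ≤ n) (hm : 0 < m) :
    2 * (n ^ 2 * maxEntry A * maxSubdet A) < 2 ^ (100 * n ^ 2 * rowEncodingSize A) := by
  have hL := maxEntry_le_two_pow A
  have hD := maxSubdet_le_two_pow A hm
  have hnφ : n ≤ rowEncodingSize A := le_rowEncodingSize A ⟨0, hm⟩
  set φ := rowEncodingSize A
  have h1 : n ≤ 2 ^ φ := hnφ.trans Nat.lt_two_pow_self.le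
  calc _ ≤ 2 * ((2 ^ φ) ^ 2 * 2 ^ φ * 2 ^ (2 * n * φ)) := by gcongr
    _ = 2 ^ (1 + 3 * φ + 2 * (n * φ)) := by ring
    _ < _ := Nat.pow_lt_pow_right one_lt_two (by
        have h2 : n * φ ≤ n ^ 2 * φ := Nat.mul_le_mul_right _ (Nat.le_self_pow two_ne_zero n)
        have h3 : φ ≤ n * φ := Nat.le_mul_of_pos_left _ hn
        linarith)

lemma box_slack_bound_lt_two_pow (hn : 1 ≤ n) (hm : 0 < m) :
    2 * (n * maxSubdet A) < 2 ^ (100 * n ^ 2 * rowEncodingSize A) := by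
  have hD := maxSubdet_le_two_pow A hm
  have hnφ : n ≤ rowEncodingSize A := le_rowEncodingSize A ⟨0, hm⟩
  set φ := rowEncodingSize A
  have h1 : n ≤ 2 ^ φ := hnφ.trans Nat.lt_two_pow_self.le
  calc _ ≤ 2 * (2 ^ φ * 2 ^ (2 * n * φ)) := by gcongr
    _ = 2 ^ (1 + φ + 2 * (n * φ)) := by ring
    _ < _ := Nat.pow_lt_pow_right one_lt_two (by
        have h2 : n * φ ≤ n ^ 2 * φ := Nat.mul_le_mul_right _ (Nat.le_self_pow two_ne_zero n)
        have h3 : φ ≤ n * φ := Nat.le_mul_of_pos_left _ hn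
        linarith)

/-- Two levels more than double the slack, as (3/2)² > 2; the spare powers of 2 absorb the initial
1/2. -/
lemma two_pow_le_level {k : ℕ} (hk : 1 ≤ k) : (2 : ℝ) ^ (15 * k) ≤ level (32 * k) := by
  calc (2 : ℝ) ^ (15 * k) ≤ 2 ^ (16 * k - 1) := pow_le_pow_right₀ one_le_two (by omega)
    _ = 1 / 2 * 2 ^ (16 * k) := by
        obtain ⟨l, hl⟩ : ∃ l, 16 * k = l + 1 := ⟨16 * k - 1, by omega⟩
        rw [hl, Nat.add_sub_cancel, pow_succ]; ring
    _ ≤ 1 / 2 * ((3 / 2) ^ 2) ^ (16 * k) := by gcongr; norm_num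
    _ = level (32 * k) := by rw [level, ← pow_mul]; congr 2; ring

end Sizes

/-! ### The system of the corner relaxation -/

section Corner

variable {n m : ℕ} {A : Matrix (Fin m) (Fin n) ℤ} {b : Fin m → ℝ} {x : Fin n → ℝ}

lemma row_cornerMatrix_inl (i : KeptRow A b x) (y : Fin n → ℝ) :
    row (cornerMatrix A b x) (Sum.inl i) y = row A i.1 y := rfl

lemma row_cornerMatrix_inr_inl (k : Fin n) (y : Fin n → ℝ) :
    row (cornerMatrix A b x) (Sum.inr (Sum.inl k)) y = y k := by
  change ∑ l, (((if l = k then 1 else 0 : ℤ)) : ℝ) * y l = y k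
  simp

lemma row_cornerMatrix_inr_inr (k : Fin n) (y : Fin n → ℝ) :
    row (cornerMatrix A b x) (Sum.inr (Sum.inr k)) y = -y k := by
  change ∑ l, (((if l = k then -1 else 0 : ℤ)) : ℝ) * y l = -y k
  simp

lemma abs_row_sub_le {y : Fin n → ℝ} (hy : ∀ k, |y k - x k| ≤ (n : ℝ) * maxSubdet A) (i : Fin m) :
    |row A i y - row A i x| ≤ (n : ℝ) ^ 2 * maxEntry A * maxSubdet A := by
  have := abs_row_le i (abs_entry_le A i) (x := y - x) hy
  rw [map_sub] at this
  calc _ ≤ _ := this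
    _ = _ := by ring

/-- A dropped row has more slack at `x` than it can lose within the box, so it is redundant. -/
lemma polyhedron_cornerMatrix :
    polyhedron (cornerMatrix A b x) (cornerRHS A b x) = cornerRelaxation A b x := by
  ext y
  rw [mem_polyhedron]
  constructor
  · intro h
    have hbox : ∀ k, |y k - x k| ≤ (n : ℝ) * maxSubdet A := fun k => by
      have h1 := h (Sum.inr (Sum.inl k))
      have h2 := h (Sum.inr (Sum.inr k))
      rw [row_cornerMatrix_inr_inl] at h1
      rw [row_cornerMatrix_inr_inr] at h2
      simp only [cornerRHS, Sum.elim_inr, Sum.elim_inl] at h1 h2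
      rw [abs_le]
      constructor <;> linarith
    refine ⟨fun i => ?_, hbox⟩
    rw [← row_apply]
    by_cases hi : b i - row A i x ≤ (n : ℝ) ^ 2 * maxEntry A * maxSubdet A
    · exact h (Sum.inl ⟨i, hi⟩)
    · have := (abs_le.1 (abs_row_sub_le hbox i)).2
      linarith
  · rintro ⟨hP, hbox⟩ (i | k | k)
    · exact hP i.1
    · rw [row_cornerMatrix_inr_inl]
      simp only [cornerRHS, Sum.elim_inr, Sum.elim_inl]
      linarith [(abs_le.1 (hbox k)).2]
    · rw [row_cornerMatrix_inr_inr]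
      simp only [cornerRHS, Sum.elim_inr]
      linarith [(abs_le.1 (hbox k)).1]

/-- The factor 2 adds the slack at the corner `x` to the variation of the row over the box; both
obey the same bound. -/
lemma ckhmHypothesis_corner {M : ℕ}
    (h1 : 2 * ((n : ℝ) ^ 2 * maxEntry A * maxSubdet A) < 2 ^ M)
    (h2 : 2 * ((n : ℝ) * maxSubdet A) < 2 ^ M) :
    CKHMHypothesis (cornerMatrix A b x) (cornerRHS A b x) M := by
  intro i v hv
  have hv' := integerHull_subset _ convex_polyhedron hv.1
  rw [polyhedron_cornerMatrix] at hv'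
  rw [← row_apply]
  rcases i with i | k | k
  · rw [row_cornerMatrix_inl]
    have := (abs_le.1 (abs_row_sub_le hv'.2 i.1)).1
    have h3 : b i.1 - row A i.1 x ≤ (n : ℝ) ^ 2 * maxEntry A * maxSubdet A := i.2
    simp only [cornerRHS, Sum.elim_inl]
    linarith
  · rw [row_cornerMatrix_inr_inl]
    simp only [cornerRHS, Sum.elim_inr, Sum.elim_inl]
    linarith [(abs_le.1 (hv'.2 k)).1]
  · rw [row_cornerMatrix_inr_inr]
    simp only [cornerRHS, Sum.elim_inr]
    linarith [(abs_le.1 (hv'.2 k)).2]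

end Corner

/-! ### Dimension one and the final vertex bound -/

lemma mem_openSegment_fin_one {x y z : Fin 1 → ℝ} (h1 : x 0 < y 0) (h2 : y 0 < z 0) :
    y ∈ openSegment ℝ x z := by
  have h3 : 0 < z 0 - x 0 := by linarith
  refine ⟨(z 0 - y 0) / (z 0 - x 0), (y 0 - x 0) / (z 0 - x 0), div_pos (by linarith) h3,
    div_pos (by linarith) h3, by field_simp; ring, ?_⟩
  ext k
  rw [Fin.fin_one_eq_zero k]
  simp only [Pi.add_apply, Pi.smul_apply, smul_eq_mul]
  field_simp
  ring

/-- A set in dimension one has at most two extreme points. -/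
lemma encard_extremePoints_fin_one_le (S : Set (Fin 1 → ℝ)) :
    (Set.extremePoints ℝ S).encard ≤ 2 := by
  by_contra h
  rw [not_le] at h
  obtain ⟨t, htS, ht⟩ := Set.exists_subset_encard_eq (Order.add_one_le_of_lt h)
  obtain ⟨x, y, z, hxy, hxz, hyz, rfl⟩ := Set.encard_eq_three.1 (ht.trans (by norm_num))
  have hx : x ∈ Set.extremePoints ℝ S := htS (by simp)
  have hy : y ∈ Set.extremePoints ℝ S := htS (by simp)
  have hz : z ∈ Set.extremePoints ℝ S := htS (by simp)
  have hne : ∀ {x y : Fin 1 → ℝ}, x ≠ y → x 0 ≠ y 0 := fun hxy h0 => hxy (by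
    ext k; rw [Fin.fin_one_eq_zero k]; exact h0)
  have key : ∀ {x y z : Fin 1 → ℝ}, x ∈ Set.extremePoints ℝ S → y ∈ Set.extremePoints ℝ S →
      z ∈ Set.extremePoints ℝ S → x 0 < y 0 → y 0 < z 0 → False := fun hx hy hz h1 h2 => by
    have := hy.2 hx.1 hz.1 (mem_openSegment_fin_one h1 h2)
    rw [this] at h1
    exact lt_irrefl _ h1
  rcases lt_or_gt_of_ne (hne hxy) with a | a <;> rcases lt_or_gt_of_ne (hne hxz) with c | c <;>
    rcases lt_or_gt_of_ne (hne hyz) with d | d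
  · exact key hx hy hz a d
  · exact key hx hz hy c d
  · linarith
  · exact key hz hx hy c a
  · exact key hy hx hz a c
  · linarith
  · exact key hy hz hx d c
  · exact key hz hy hx d a

/-- As `n - 1 ≥ 1`, the prefactor, at most `10n`, can be moved under the exponent, leaving a
comparison of bases. -/
lemma count_bound {n m φ : ℕ} (hn : 2 ≤ n) (hm : 1 ≤ m) (hφ : 1 ≤ φ) :
    6 * (n + 1) * (m * (m * (32 * (n * φ) + 1) + 1) ^ (n - 1)) + 1 ≤
      2 * m ^ n * (6 * n ^ 2 * (100 * n ^ 2 * φ)) ^ (n - 1) := by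
  obtain ⟨d, rfl⟩ : ∃ d, n = d + 2 := ⟨n - 2, by omega⟩
  set n := d + 2 with hd
  rw [show n - 1 = d + 1 by omega]
  have hnφ : 1 ≤ n * φ := Nat.mul_pos (by omega) hφ
  have h1 : m * (32 * (n * φ) + 1) + 1 ≤ m * (34 * (n * φ)) := by nlinarith
  have h2 : (10 * n) * (34 * (n * φ)) ≤ 6 * n ^ 2 * (100 * n ^ 2 * φ) := by
    have : n ^ 2 * φ * 4 ≤ n ^ 2 * φ * n ^ 2 := Nat.mul_le_mul_left _ (by nlinarith)
    nlinarith
  have h3 : 1 ≤ m * (m * (34 * (n * φ))) ^ (d + 1) :=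
    Nat.mul_pos hm (pow_pos (by positivity) _)
  calc 6 * (n + 1) * (m * (m * (32 * (n * φ) + 1) + 1) ^ (d + 1)) + 1
      ≤ 6 * (n + 1) * (m * (m * (34 * (n * φ))) ^ (d + 1)) +
          1 * (m * (m * (34 * (n * φ))) ^ (d + 1)) := by
        rw [one_mul]; gcongr
    _ = (6 * (n + 1) + 1) * (m * (m * (34 * (n * φ))) ^ (d + 1)) := by ring
    _ ≤ (10 * n) * (m * (m * (34 * (n * φ))) ^ (d + 1)) :=
        Nat.mul_le_mul_right _ (by omega)
    _ ≤ (10 * n) ^ (d + 1) * (m * (m * (34 * (n * φ))) ^ (d + 1)) :=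
        Nat.mul_le_mul_right _ (Nat.le_self_pow (by omega) _)
    _ = m ^ n * ((10 * n) * (34 * (n * φ))) ^ (d + 1) := by
        rw [hd]; simp only [mul_pow]; ring
    _ ≤ m ^ n * (6 * n ^ 2 * (100 * n ^ 2 * φ)) ^ (d + 1) :=
        Nat.mul_le_mul_left _ (Nat.pow_le_pow_left h2 _)
    _ ≤ 2 * m ^ n * (6 * n ^ 2 * (100 * n ^ 2 * φ)) ^ (d + 1) := by
        rw [mul_assoc 2]; exact Nat.le_mul_of_pos_left _ two_pos

/-- The vertex bound for the integer hull of a polytope. -/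
theorem encard_vert_integerHull_le_of_isBounded {n m : ℕ} {A : Matrix (Fin m) (Fin n) ℤ}
    {b : Fin m → ℤ} (hn : 1 ≤ n) (hm : 0 < m)
    (hb : Bornology.IsBounded (polyhedron A fun i => (b i : ℝ)))
    (hne : (polyhedron A fun i => (b i : ℝ)).Nonempty) :
    (vert (integerHull (polyhedron A fun i => (b i : ℝ)))).encard ≤
      ((2 * m ^ n * (6 * n ^ 2 * (100 * n ^ 2 * rowEncodingSize A)) ^ (n - 1) : ℕ) : ℕ∞) := by
  -- For `n = 1` the exponent is 0 and cannot absorb the constants of the class count, so the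
  -- vertices are bounded directly by 2.
  obtain rfl | hn2 := hn.eq_or_lt
  · refine (encard_extremePoints_fin_one_le _).trans ?_
    have : 2 ≤ 2 * m ^ 1 * (6 * 1 ^ 2 * (100 * 1 ^ 2 * rowEncodingSize A)) ^ (1 - 1) := by
      simp; omega
    exact_mod_cast this
  have hker := eq_zero_of_row_eq_zero hb hne
  have hφ : 1 ≤ rowEncodingSize A := hn.trans (le_rowEncodingSize A ⟨0, hm⟩)
  have hD : 1 ≤ maxSubdet A := by
    obtain ⟨f, -, hf⟩ := exists_submatrix_det_ne_zero (A := A) Set.univ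
      fun w hw => hker w fun i => hw i trivial
    exact (Int.natAbs_pos.2 hf).trans_le (natAbs_det_submatrix_le A hn le_rfl f id)
  have hL : 1 ≤ maxEntry A := by
    by_contra h
    have h0 : ∀ i k, (A i k : ℝ) = 0 := fun i k => by
      have := abs_entry_le A i k
      rw [show maxEntry A = 0 by omega] at this
      simpa using this
    have := congrFun (hker 1 fun i => by simp [row_apply, h0]) ⟨0, hn⟩
    simp at this
  -- This is the left side of the third condition on `T` multiplied out; it also dominates the
  -- second.
  have hlev : ((12 * (n + 1) * n ^ 4 * maxEntry A ^ 2 * maxSubdet A ^ 2 : ℕ) : ℝ) ≤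
      level (32 * (n * rowEncodingSize A)) := by
    refine le_trans ?_ (two_pow_le_level (Nat.mul_pos hn hφ))
    rw [← mul_assoc]
    exact_mod_cast slack_bound_le_two_pow A hn hm
  have hX : 1 ≤ n ^ 2 * maxEntry A * maxSubdet A := by
    have : 0 < n ^ 2 * maxEntry A * maxSubdet A := by positivity
    exact this
  have h1 : 1 ≤ 2 * (n + 1) * (n * maxEntry A * (n * maxSubdet A)) := by
    have : 0 < 2 * (n + 1) * (n * maxEntry A * (n * maxSubdet A)) := by positivity
    exact this
  have h2 : 2 * (n + 1) * (n * maxEntry A * (n * maxSubdet A)) ≤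
      12 * (n + 1) * n ^ 4 * maxEntry A ^ 2 * maxSubdet A ^ 2 :=
    calc _ = 2 * (n + 1) * (n ^ 2 * maxEntry A * maxSubdet A) * 1 := by ring
      _ ≤ 12 * (n + 1) * (n ^ 2 * maxEntry A * maxSubdet A) *
          (n ^ 2 * maxEntry A * maxSubdet A) := by gcongr; norm_num
      _ = _ := by ring
  refine (encard_vert_integerHull_le hb hne (T := 32 * (n * rowEncodingSize A)) ?_ ?_ ?_).trans ?_
  · exact_mod_cast h1
  · exact le_trans (by exact_mod_cast h2) hlev
  · refine le_trans (le_of_eq ?_) hlev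
    push_cast; ring
  · exact_mod_cast count_bound hn2 hm hφ

end IntHull

/-! ### Assembly of the three claims -/

theorem mainTheorem5 :
    ∃ M : ℕ → ℕ → ℕ,
      (∃ C : ℕ, ∀ n φ : ℕ, 1 ≤ n → 1 ≤ φ → 1 ≤ M n φ ∧ M n φ ≤ C * n ^ 2 * φ) ∧
      ∀ (n m : ℕ) (A : Matrix (Fin m) (Fin n) ℤ) (b : Fin m → ℤ),
        1 ≤ n →
        Bornology.IsBounded (IntHull.polyhedron A (fun i => (b i : ℝ))) →
        (IntHull.polyhedron A (fun i => (b i : ℝ)) ∩ IntHull.lattice n).Nonempty →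
        -- every vertex of the integer hull is a vertex of the integer hull of a corner relaxation
        (∀ v ∈ IntHull.vert (IntHull.integerHull (IntHull.polyhedron A (fun i => (b i : ℝ)))),
          ∃ x ∈ IntHull.vert (IntHull.polyhedron A (fun i => (b i : ℝ))),
            v ∈ IntHull.vert
              (IntHull.integerHull (IntHull.cornerRelaxation A (fun i => (b i : ℝ)) x))) ∧
        -- the hypothesis holds, with `M` independent of `b`, for every corner relaxation
        (∀ x ∈ IntHull.vert (IntHull.polyhedron A (fun i => (b i : ℝ))),
          IntHull.polyhedron (IntHull.cornerMatrix A (fun i => (b i : ℝ)) x)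
              (IntHull.cornerRHS A (fun i => (b i : ℝ)) x) =
            IntHull.cornerRelaxation A (fun i => (b i : ℝ)) x ∧
          IntHull.CKHMHypothesis (IntHull.cornerMatrix A (fun i => (b i : ℝ)) x)
            (IntHull.cornerRHS A (fun i => (b i : ℝ)) x)
            (M n (IntHull.rowEncodingSize A))) ∧
        -- the vertex bound; in particular the vertex set is finite
        (IntHull.vert
            (IntHull.integerHull (IntHull.polyhedron A (fun i => (b i : ℝ))))).encard ≤
          ((2 * m ^ n * (6 * n ^ 2 * M n (IntHull.rowEncodingSize A)) ^ (n - 1) : ℕ) : ℕ∞) := by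
  -- All slack bounds have logarithm O(nφ); this choice covers them and leaves room for the
  -- prefactors of the count.
  refine ⟨fun n φ => 100 * n ^ 2 * φ, ⟨100, fun n φ hn hφ => ⟨?_, le_rfl⟩⟩, ?_⟩
  · exact Nat.mul_pos (by positivity) hφ
  intro n m A b hn hb ⟨z, hz, hzl⟩
  have hm : 0 < m := by
    by_contra h
    obtain rfl : m = 0 := by omega
    have := congrFun (IntHull.eq_zero_of_row_eq_zero hb ⟨z, hz⟩ 1 fun i => i.elim0) ⟨0, hn⟩
    simp at this
  refine ⟨fun v hv => ?_, fun x _ => ⟨IntHull.polyhedron_cornerMatrix,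
    IntHull.ckhmHypothesis_corner ?_ ?_⟩,
    IntHull.encard_vert_integerHull_le_of_isBounded hn hm hb ⟨z, hz⟩⟩
  · obtain ⟨x, hx, hvx⟩ := IntHull.exists_vert_near hb hv
    have hvP := IntHull.vert_integerHull_subset _ hv
    -- An extreme point of the larger hull that lies in the smaller one is extreme there.
    exact ⟨x, hx, inter_extremePoints_subset_extremePoints_of_subset
      (convexHull_mono (Set.inter_subset_inter_left _ Set.inter_subset_left))
      ⟨subset_convexHull ℝ _ ⟨⟨hvP.1, hvx⟩, hvP.2⟩, hv⟩⟩
  · exact_mod_cast IntHull.row_slack_bound_lt_two_pow A hn hm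
  · exact_mod_cast IntHull.box_slack_bound_lt_two_pow A hn hm
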